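/- Let $(R,\mathfrak m)$ be a complete Noetherian local commutative ring, let $\mathfrak p\subset R$ be a prime ideal, and let $\widehat{R_\mathfrak p}$ be the completion of $R_\mathfrak p$ at its maximal ideal. For an $R$-module $N$ let $\widehat{N_\mathfrak p}$ be the completion of $N_\mathfrak p$ at the maximal ideal of $R_\mathfrak p$. Let $E=E_R(R/\mathfrak m)$ and $E'=E_R(R/\mathfrak p)$ be injective hulls over $R$, where $E'$ carries its $\widehat{R_\mathfrak p}$-module structure extending that over $R$. Write $N^\vee=\operatorname{Hom}_R(N,E)$ for an $R$-module $N$, and $U^{\vee'}=\operatorname{Hom}_{\widehat{R_\mathfrak p}}(U,E')$ for an $\widehat{R_\mathfrak p}$-module $U$. The colocalization of an $R$-module $M$ at $\mathfrak p$ is the $\widehat{R_\mathfrak p}$-module ${}^{\mathfrak p}M=\operatorname{Hom}_R(M^\vee,E')$. A submodule selector on a class of modules is a rule $\alpha$ assigning to each module $M$ of the class a submodule $\alpha(M)\subseteq M$ such that $\varphi(\alpha(M))=\alpha(N)$ for every isomorphism $\varphi:M\to N$ of modules of the class. Let $\sigma$ be a submodule selector on Artinian $R$-modules and $\sigma'$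 a submodule selector on Artinian $\widehat{R_\mathfrak p}$-modules. Let $\tau=\sigma^\smile$ and $\tau'=(\sigma')^\smile$ be their smile duals: $\tau(N)=(N^\vee/\sigma(N^\vee))^\vee$, regarded as a submodule of $N\cong N^{\vee\vee}$ for finitely generated $R$-modules $N$, and likewise $\tau'(U)=(U^{\vee'}/\sigma'(U^{\vee'}))^{\vee'}\subseteq U$ for finitely generated $\widehat{R_\mathfrak p}$-modules $U$. Then the following are equivalent: 1. $\tau'(\widehat{N_\mathfrak p})=\widehat{\tau(N)_\mathfrak p}$ as submodules of $\widehat{N_\mathfrak p}$, for all finitely generated $R$-modules $N$; 2. $\sigma'({}^{\mathfrak p}M)={}^{\mathfrak p}\sigma(M)$ as submodules of ${}^{\mathfrak p}M$, for all Artinian $R$-modules $M$. Here $\widehat{\tau(N)_\mathfrak p}$ and ${}^{\mathfrak p}\sigma(M)$ are identified with their images under the (injective) maps induced by the inclusions $\tau(N)\subseteq N$ and $\sigma(M)\subseteq M$. -/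

import Mathlib

universe u

/-- `i : M → E` is an injective hull of `M`: `E` is an injective module, `i` is injective, and
`E` is an essential extension of the image of `i`. -/
structure IsInjectiveHull {R : Type u} [CommRing R] {M E : Type u} [AddCommGroup M] [Module R M]
    [AddCommGroup E] [Module R E] (i : M →ₗ[R] E) : Prop where
  injective_module : Module.Injective R E
  injective : Function.Injective i
  essential : ∀ L : Submodule R E, L ⊓ LinearMap.range i = ⊥ → L = ⊥

/-- A class of `R`-modules. -/
abbrev ModuleClass (R : Type u) [CommRing R] : Type (u + 1) :=
  ∀ (M : Type u) [AddCommGroup M] [Module R M], Prop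

/-- The class of Artinian `R`-modules. -/
abbrev artinianModules (R : Type u) [CommRing R] : ModuleClass R :=
  fun M _ _ => IsArtinian R M

/-- A submodule selector on a class `𝓜` of modules: it assigns to each module `M` in `𝓜` a
submodule of `M`, compatibly with isomorphisms. The values of `toFun` outside `𝓜` are
unconstrained and carry no meaning. -/
structure SubmoduleSelector (R : Type u) [CommRing R] (𝓜 : ModuleClass R) where
  toFun : ∀ (M : Type u) [AddCommGroup M] [Module R M], Submodule R M
  map_equiv : ∀ (M N : Type u) [AddCommGroup M] [Module R M] [AddCommGroup N] [Module R N]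
    (φ : M ≃ₗ[R] N), 𝓜 M → 𝓜 N → (toFun M).map φ.toLinearMap = toFun N

section Smile

variable {R : Type u} [CommRing R] {𝓜 : ModuleClass R} (E : Type u) [AddCommGroup E] [Module R E]

/-- The submodule `(N^∨ / α(N^∨))^∨` of `N`, where `(-)^∨ = Hom_R(-, E)`: the elements of `N` whose
image under the evaluation map `N → N^∨∨` lies in the image of the (injective) dual
`(N^∨ / α(N^∨))^∨ → N^∨∨` of the projection `N^∨ → N^∨ / α(N^∨)`. -/
def SubmoduleSelector.smileFun (α : SubmoduleSelector R 𝓜) (N : Type u) [AddCommGroup N]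
    [Module R N] : Submodule R N :=
  (LinearMap.range (LinearMap.lcomp R E (α.toFun (N →ₗ[R] E)).mkQ)).comap
    (LinearMap.applyₗ : N →ₗ[R] (N →ₗ[R] E) →ₗ[R] E)

theorem SubmoduleSelector.mem_smileFun (α : SubmoduleSelector R 𝓜) (N : Type u) [AddCommGroup N]
    [Module R N] (z : N) : z ∈ α.smileFun E N ↔ ∀ g ∈ α.toFun (N →ₗ[R] E), g z = 0 := by
  constructor
  · rintro ⟨f, hf⟩ g hg
    have h := LinearMap.congr_fun hf g
    have h0 : (α.toFun (N →ₗ[R] E)).mkQ g = 0 := by simpa using hg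
    rw [LinearMap.lcomp_apply, h0, map_zero] at h
    exact h.symm
  · intro h
    refine ⟨(α.toFun (N →ₗ[R] E)).liftQ (LinearMap.applyₗ z) fun g hg => ?_, ?_⟩
    · exact h g hg
    · ext g
      rfl

/-- The smile dual `α^⌣` of `α`, a submodule selector on the modules whose dual lies in `𝓜`. -/
def SubmoduleSelector.smile (α : SubmoduleSelector R 𝓜) :
    SubmoduleSelector R (fun N _ _ => 𝓜 (N →ₗ[R] E)) where
  toFun N _ _ := α.smileFun E N
  map_equiv M N _ _ _ _ φ hM hN := by
    have key := α.map_equiv (M →ₗ[R] E) (N →ₗ[R] E)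
      (φ.congrLeft E R) hM hN
    ext z
    rw [Submodule.mem_map_equiv, mem_smileFun, mem_smileFun, ← key]
    constructor
    · rintro h _ ⟨g, hg, rfl⟩
      exact h g hg
    · intro h g hg
      exact h _ ⟨g, hg, rfl⟩

end Smile

section LocalizationCompletion

variable {R : Type u} [CommRing R] (p : Ideal R) [p.IsPrime]

/-- The completion of the local ring `R_p` at its maximal ideal. -/
abbrev LocCompl : Type u :=
  AdicCompletion (IsLocalRing.maximalIdeal (Localization.AtPrime p)) (Localization.AtPrime p)

/-- The completion of the `R_p`-module `N_p` at the maximal ideal of `R_p`. -/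
abbrev LocComplModule (N : Type u) [AddCommGroup N] [Module R N] : Type u :=
  AdicCompletion (IsLocalRing.maximalIdeal (Localization.AtPrime p))
    (LocalizedModule p.primeCompl N)

/-- The map that a linear map `N → N'` induces on completed localizations. -/
noncomputable def LocComplModule.map {N N' : Type u} [AddCommGroup N] [Module R N]
    [AddCommGroup N'] [Module R N'] (f : N →ₗ[R] N') :
    LocComplModule p N →ₗ[LocCompl p] LocComplModule p N' :=
  AdicCompletion.map (IsLocalRing.maximalIdeal (Localization.AtPrime p))
    (LocalizedModule.map p.primeCompl f)

/-- The completed localization of a submodule `L` of `N`, as a submodule of that of `N`. -/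
noncomputable def LocComplModule.ofSubmodule {N : Type u} [AddCommGroup N] [Module R N]
    (L : Submodule R N) : Submodule (LocCompl p) (LocComplModule p N) :=
  LinearMap.range (LocComplModule.map p L.subtype)

end LocalizationCompletion

section Colocalization

/-- The Richardson colocalization `Hom_R(Hom_R(M, E), E')`, where `E` and `E'` stand for
the injective hulls of `R/m` and `R/p`. It is a module over the completion of `R_p` because
`E'` is one. -/
abbrev Coloc (R : Type u) [CommRing R] (E E' M : Type u) [AddCommGroup E] [Module R E]
    [AddCommGroup E'] [Module R E'] [AddCommGroup M] [Module R M] : Type u :=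
  (M →ₗ[R] E) →ₗ[R] E'

variable {R : Type u} [CommRing R] (S : Type u) [CommRing S] [Algebra R S]
  (E E' : Type u) [AddCommGroup E] [Module R E] [AddCommGroup E'] [Module R E'] [Module S E']
  [IsScalarTower R S E']

/-- The map that a linear map `M → M'` induces on colocalizations. -/
def Coloc.map {M M' : Type u} [AddCommGroup M] [Module R M] [AddCommGroup M'] [Module R M']
    (f : M →ₗ[R] M') : Coloc R E E' M →ₗ[S] Coloc R E E' M' :=
  LinearMap.lcomp S E' (LinearMap.lcomp R E f)

/-- The colocalization of a submodule `L` of `M`, as a submodule of that of `M`. -/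
def Coloc.ofSubmodule {M : Type u} [AddCommGroup M] [Module R M] (L : Submodule R M) :
    Submodule S (Coloc R E E' M) :=
  LinearMap.range (Coloc.map S E E' L.subtype)

end Colocalization

/-! Write `S` for the completion of `R_p`. The proof is Matlis duality used twice, over `R` with `E`
and over `S` with `E'`. The second use is legitimate because `S` is Noetherian and `E'` is an
injective hull of the residue field over `S` (`IsInjectiveHull.exists_isInjectiveHull_locCompl`).
For finitely generated `N`, reflexivity and base change give `Hom_S(U, E') ≅ Hom_R(N, E') ≅
Hom_R(N^∨∨, E')`, where `U` is the completed localization of `N`; so the dual of `U` is the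
colocalization of `N^∨`. Since `τ(N)` is the annihilator of `σ(N^∨)` in `N`, the colocalization of
`σ(N^∨)` corresponds to the annihilator of `L`, the completed localization of `τ(N)`. Condition 1
for `N` thus says that `σ'(U^∨')` has annihilator `L` in `U`, and condition 2 for `N^∨` that
`σ'(U^∨')` is the annihilator of `L`. These agree by the double annihilator theorem. Every Artinian
`M` is isomorphic to some `N^∨` (`IsInjectiveHull.exists_linearEquiv_dual`), and selectors respect
isomorphisms. -/

/-! ### Adic completions of Noetherian rings are Noetherian. -/

section CompletionNoetherian

variable {A S : Type*} [CommRing A] [CommRing S] [Algebra A S] (I : Ideal A)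

/-- If `A → S / IS` is surjective, then elements of `Iⁿ S` are, modulo `Iⁿ⁺¹ S`, images of elements
of `Iⁿ`. -/
theorem Ideal.exists_sub_mem_pow_succ_of_mem_pow_map
    (h : ∀ s : S, ∃ a : A, s - algebraMap A S a ∈ I.map (algebraMap A S)) (n : ℕ) {x : S}
    (hx : x ∈ I.map (algebraMap A S) ^ n) :
    ∃ a ∈ I ^ n, x - algebraMap A S a ∈ I.map (algebraMap A S) ^ (n + 1) := by
  rw [← Ideal.map_pow] at hx
  induction hx using Submodule.span_induction with
  | mem x hx =>
    obtain ⟨a, ha, rfl⟩ := hx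
    exact ⟨a, ha, by simp⟩
  | zero => exact ⟨0, zero_mem _, by simp⟩
  | add x y _ _ hx hy =>
    obtain ⟨a, ha, hxa⟩ := hx
    obtain ⟨b, hb, hyb⟩ := hy
    exact ⟨a + b, add_mem ha hb, by simpa [add_sub_add_comm] using add_mem hxa hyb⟩
  | smul s x _ hx =>
    obtain ⟨a, ha, hxa⟩ := hx
    obtain ⟨b, hb⟩ := h s
    refine ⟨b * a, Ideal.mul_mem_left _ _ ha, ?_⟩
    have h1 : s * (x - algebraMap A S a) ∈ I.map (algebraMap A S) ^ (n + 1) :=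
      Ideal.mul_mem_left _ _ hxa
    have h2 : (s - algebraMap A S b) * algebraMap A S a ∈ I.map (algebraMap A S) ^ (n + 1) := by
      rw [pow_succ']
      refine Ideal.mul_mem_mul hb ?_
      rw [← Ideal.map_pow]
      exact Ideal.mem_map_of_mem _ ha
    convert add_mem h1 h2 using 1
    rw [map_mul, smul_eq_mul]
    ring

theorem Ideal.exists_sub_mem_pow_map
    (h : ∀ s : S, ∃ a : A, s - algebraMap A S a ∈ I.map (algebraMap A S)) (n : ℕ) (s : S) :
    ∃ a : A, s - algebraMap A S a ∈ I.map (algebraMap A S) ^ n := by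
  induction n with
  | zero => exact ⟨0, by simp⟩
  | succ n ih =>
    obtain ⟨a, ha⟩ := ih
    obtain ⟨b, -, hb⟩ := I.exists_sub_mem_pow_succ_of_mem_pow_map h n ha
    exact ⟨a + b, by simpa [sub_sub] using hb⟩

/-- The filtration of `A` by the elements of `Iⁿ` that are initial forms of elements of `J`. -/
def Ideal.initialFiltration (J : Ideal S) : I.Filtration A where
  N n := I ^ n ⊓ (J ⊔ I.map (algebraMap A S) ^ (n + 1)).comap (algebraMap A S)
  mono n := by
    rintro a ⟨ha, -⟩
    refine ⟨Ideal.pow_le_pow_right n.le_succ ha, ?_⟩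
    refine Ideal.mem_sup_right ?_
    rw [← Ideal.map_pow]
    exact Ideal.mem_map_of_mem _ ha
  smul_le n := by
    rw [Submodule.smul_le]
    rintro r hr a ⟨ha, ha'⟩
    refine ⟨by rw [pow_succ']; exact Ideal.mul_mem_mul hr ha, ?_⟩
    obtain ⟨y, hy, z, hz, hyz⟩ := Submodule.mem_sup.mp (Ideal.mem_comap.mp ha')
    rw [SetLike.mem_coe, Ideal.mem_comap, smul_eq_mul, map_mul, ← hyz, mul_add, pow_succ' _ (n + 1)]
    exact Submodule.add_mem_sup (Ideal.mul_mem_left _ _ hy)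
      (Ideal.mul_mem_mul (Ideal.mem_map_of_mem _ hr) hz)

/-- Artin–Rees: this is a subfiltration of the `I`-adic filtration of a Noetherian ring. -/
theorem Ideal.initialFiltration_stable [IsNoetherianRing A] (J : Ideal S) :
    (I.initialFiltration J).Stable := by
  refine (I.stableFiltration_stable ⊤).of_le fun n => ?_
  simp [Ideal.initialFiltration]

/-- Successive approximation in a `K`-adically complete ring: if every element of `T n` agrees, up
to an element of `T (n + 1)`, with a combination of the `g i` with coefficients in `Kⁿ`, then the
elements of `T 0` are combinations of the `g i`. -/
theorem Ideal.mem_span_range_of_forall_exists_approx {K : Ideal S} [IsAdicComplete K S] {ι : Type*}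
    [Fintype ι] (g : ι → S) (T : ℕ → Set S) (hT : ∀ n, T n ⊆ (K ^ n : Ideal S))
    (happ : ∀ n, ∀ y ∈ T n, ∃ d : ι → S, (∀ i, d i ∈ K ^ n) ∧ y - ∑ i, d i * g i ∈ T (n + 1))
    {x : S} (hx : x ∈ T 0) : x ∈ Ideal.span (Set.range g) := by
  choose! d hdK hdT using happ
  let y : ℕ → S := fun n => Nat.rec x (fun n y => y - ∑ i, d n y i * g i) n
  have hy0 : y 0 = x := rfl
  have hys (n : ℕ) : y (n + 1) = y n - ∑ i, d n (y n) i * g i := rfl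
  have hyT (n : ℕ) : y n ∈ T n := by
    induction n with
    | zero => exact hx
    | succ n ih => rw [hys]; exact hdT n _ ih
  -- Partial sums of the coefficients, with `y n` the remainder after `n` corrections. They are
  -- Cauchy because the `j`-th term lies in `K ^ j`.
  let c : ι → ℕ → S := fun i n => ∑ j ∈ Finset.range n, d j (y j) i
  have hxc (n : ℕ) : x - ∑ i, c i n * g i = y n := by
    induction n with
    | zero => simp [c, hy0]
    | succ n ih =>
      rw [hys, sub_eq_iff_eq_add.mp ih]
      simp only [c, Finset.sum_range_succ, add_mul, Finset.sum_add_distrib]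
      ring
  have hlim (i : ι) : ∃ L : S, ∀ n, c i n - L ∈ K ^ n := by
    obtain ⟨L, hL⟩ := IsPrecomplete.prec (I := K) (M := S) inferInstance (f := c i) (by
      intro m n hmn
      rw [SModEq.comm, SModEq.sub_mem, smul_eq_mul, Ideal.mul_top]
      simp only [c]
      rw [← Finset.sum_Ico_eq_sub _ hmn]
      refine Ideal.sum_mem _ fun j hj => ?_
      exact Ideal.pow_le_pow_right (Finset.mem_Ico.mp hj).1 (hdK j _ (hyT j) i))
    exact ⟨L, fun n => by simpa [SModEq.sub_mem] using hL n⟩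
  choose L hL using hlim
  have hzero : x - ∑ i, L i * g i = 0 := by
    refine IsHausdorff.haus (I := K) (M := S) inferInstance _ fun n => ?_
    rw [SModEq.zero, smul_eq_mul, Ideal.mul_top]
    have : x - ∑ i, L i * g i = y n + ∑ i, (c i n - L i) * g i := by
      rw [← hxc n]
      simp only [sub_mul, Finset.sum_sub_distrib]
      ring
    rw [this]
    exact add_mem (hT n (hyT n)) (Ideal.sum_mem _ fun i _ => Ideal.mul_mem_right _ _ (hL i n))
  rw [sub_eq_zero.mp hzero]
  exact Ideal.sum_mem _ fun i _ => Ideal.mul_mem_left _ _ (Ideal.subset_span ⟨i, rfl⟩)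

/-- An algebra `S` over a Noetherian ring `A` that is complete for `IS` is Noetherian if `A` maps
onto `S / IS`. -/
theorem isNoetherianRing_of_isAdicComplete_map [IsNoetherianRing A]
    [IsAdicComplete (I.map (algebraMap A S)) S]
    (h : ∀ s : S, ∃ a : A, s - algebraMap A S a ∈ I.map (algebraMap A S)) :
    IsNoetherianRing S := by
  set K := I.map (algebraMap A S) with hK
  have hpow {n : ℕ} {a : A} (ha : a ∈ I ^ n) : algebraMap A S a ∈ K ^ n := by
    rw [hK, ← Ideal.map_pow]
    exact Ideal.mem_map_of_mem _ ha
  refine (isNoetherianRing_iff_ideal_fg S).mpr fun J => ?_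
  obtain ⟨n₀, hn₀⟩ := (I.initialFiltration_stable J).exists_pow_smul_eq
  -- `J` is treated in two pieces: its image in `S ⧸ K ^ n₀`, a quotient of `A` as an `A`-module,
  -- and `J ⊓ K ^ n₀`, where stability beyond `n₀` lets lifts of generators of one level suffice.
  have hquot : IsNoetherian A (S ⧸ K ^ n₀) := by
    refine isNoetherian_of_surjective
      ((Ideal.Quotient.mkₐ A (K ^ n₀)).toLinearMap ∘ₗ Algebra.linearMap A S)
      (LinearMap.range_eq_top.mpr fun s => ?_)
    obtain ⟨s, rfl⟩ := Ideal.Quotient.mk_surjective s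
    obtain ⟨a, ha⟩ := I.exists_sub_mem_pow_map h n₀ s
    exact ⟨a, ((Ideal.Quotient.mk_eq_mk_iff_sub_mem s _).mpr ha).symm⟩
  have hquot' : IsNoetherian S (S ⧸ K ^ n₀) := isNoetherian_of_tower A hquot
  refine Submodule.fg_of_fg_map_of_fg_inf_ker (K ^ n₀).mkQ (IsNoetherian.noetherian _) ?_
  rw [Submodule.ker_mkQ]
  obtain ⟨k, a, ha⟩ := Submodule.fg_iff_exists_fin_generating_family.mp
    (IsNoetherian.noetherian ((I.initialFiltration J).N n₀))
  have hmem (i : Fin k) : a i ∈ (I.initialFiltration J).N n₀ := by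
    rw [← ha]; exact Submodule.subset_span ⟨i, rfl⟩
  have hlift (i : Fin k) : ∃ g ∈ J, g - algebraMap A S (a i) ∈ K ^ (n₀ + 1) := by
    obtain ⟨y, hy, z, hz, hyz⟩ := Submodule.mem_sup.mp (Ideal.mem_comap.mp (hmem i).2)
    exact ⟨y, hy, by rw [← hyz]; simpa using hz⟩
  choose g hgJ hg using hlift
  have hgK (i : Fin k) : g i ∈ K ^ n₀ := by
    have := add_mem (Ideal.pow_le_pow_right n₀.le_succ (hg i)) (hpow (hmem i).1)
    simpa using this
  refine Submodule.fg_iff_exists_fin_generating_family.mpr ⟨k, g, le_antisymm ?_ ?_⟩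
  · rw [Submodule.span_le]
    rintro _ ⟨i, rfl⟩
    exact ⟨hgJ i, hgK i⟩
  intro x hx
  refine Ideal.mem_span_range_of_forall_exists_approx (K := K) g
    (fun n => ((J ⊓ K ^ (n₀ + n) : Ideal S) : Set S))
    (fun n y hy => Ideal.pow_le_pow_right (Nat.le_add_left n n₀) hy.2) ?_ hx
  rintro n y ⟨hyJ, hyK⟩
  -- The initial form `b` of `y` is a combination of the `a i` with coefficients in `I ^ n`;
  -- replacing `a i` by `g i` costs only an element of `K ^ (n₀ + n + 1)`.
  obtain ⟨b, hb, hyb⟩ := I.exists_sub_mem_pow_succ_of_mem_pow_map h (n₀ + n) hyK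
  have hbN : b ∈ (I.initialFiltration J).N (n₀ + n) := by
    refine ⟨hb, ?_⟩
    rw [SetLike.mem_coe, Ideal.mem_comap, ← sub_sub_cancel y (algebraMap A S b)]
    exact sub_mem (Ideal.mem_sup_left hyJ) (Ideal.mem_sup_right hyb)
  rw [hn₀, ← ha, Submodule.mem_ideal_smul_span_iff_exists_sum] at hbN
  obtain ⟨c, hc, hcb⟩ := hbN
  rw [Finsupp.sum_fintype _ _ (by simp)] at hcb
  refine ⟨fun i => algebraMap A S (c i), fun i => hpow (hc i), ?_, ?_⟩
  · exact sub_mem hyJ (Ideal.sum_mem _ fun i _ => Ideal.mul_mem_left _ _ (hgJ i))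
  · have : y - ∑ i, algebraMap A S (c i) * g i =
        (y - algebraMap A S b) - ∑ i, algebraMap A S (c i) * (g i - algebraMap A S (a i)) := by
      rw [← hcb]
      simp [mul_sub, Finset.sum_sub_distrib]
    rw [this]
    refine sub_mem hyb (Ideal.sum_mem _ fun i _ => ?_)
    have := Ideal.mul_mem_mul (hpow (hc i)) (hg i)
    rwa [← pow_add, show n + (n₀ + 1) = n₀ + n + 1 by ring] at this

theorem AdicCompletion.exists_sub_algebraMap_mem_map (I : Ideal A) (fg : I.FG)
    (s : AdicCompletion I A) : ∃ a : A, s - algebraMap A (AdicCompletion I A) a ∈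
      I.map (algebraMap A (AdicCompletion I A)) := by
  obtain ⟨a, ha⟩ := Ideal.Quotient.mk_surjective (AdicCompletion.evalOneₐ I s)
  refine ⟨a, ?_⟩
  rw [← AdicCompletion.ker_evalOneₐ_eq_map I fg, RingHom.mem_ker]
  have : AdicCompletion.evalOneₐ I (algebraMap A _ a) = Ideal.Quotient.mk I a :=
    (AdicCompletion.evalOneₐ I).commutes a
  simp [← ha, this]

/-- The adic completion of a Noetherian ring is Noetherian. -/
instance AdicCompletion.isNoetherianRing [IsNoetherianRing A] :
    IsNoetherianRing (AdicCompletion I A) :=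
  haveI := AdicCompletion.isAdicComplete_self I I.fg_of_isNoetherianRing
  isNoetherianRing_of_isAdicComplete_map I
    (AdicCompletion.exists_sub_algebraMap_mem_map I I.fg_of_isNoetherianRing)

end CompletionNoetherian

/-! ### Torsion in an injective hull of `A / p`. -/

section InjectiveHull

variable {A : Type u} [CommRing A]

/-- Every nonzero submodule of an injective hull of `M` contains a nonzero element of the image
of `M`. -/
theorem IsInjectiveHull.exists_mem_ne_zero {M E : Type u} [AddCommGroup M] [Module A M]
    [AddCommGroup E] [Module A E] {i : M →ₗ[A] E} (h : IsInjectiveHull i) {L : Submodule A E}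
    (hL : L ≠ ⊥) : ∃ c : M, i c ∈ L ∧ i c ≠ 0 := by
  by_contra! H
  refine hL (h.essential L (eq_bot_iff.mpr ?_))
  rintro _ ⟨hx, c, rfl⟩
  exact H c hx

variable {p : Ideal A} {E : Type u} [AddCommGroup E] [Module A E] {i : (A ⧸ p) →ₗ[A] E}

theorem LinearMap.smul_apply_quotient_eq_zero (i : (A ⧸ p) →ₗ[A] E) {a : A} (ha : a ∈ p)
    (c : A ⧸ p) : a • i c = 0 := by
  obtain ⟨c, rfl⟩ := Ideal.Quotient.mk_surjective c
  rw [← map_smul, ← map_zero i]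
  congr 1
  exact Ideal.Quotient.eq_zero_iff_mem.mpr (Ideal.mul_mem_right c p ha)

/-- The annihilators of `a ^ n • e` stabilize. If `a ^ n • e ≠ 0`, essentiality gives a nonzero
multiple `r • a ^ n • e` in the image of `A / p`; it is killed by `a`, so `r` kills `a ^ (n + 1) •
e` and, by stability, `a ^ n • e`. -/
theorem IsInjectiveHull.exists_pow_smul_eq_zero [IsNoetherianRing A] (h : IsInjectiveHull i)
    {a : A} (ha : a ∈ p) (e : E) : ∃ n : ℕ, a ^ n • e = 0 := by
  have hmono : Monotone fun n : ℕ => Ideal.torsionOf A E (a ^ n • e) := by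
    refine monotone_nat_of_le_succ fun n r hr => ?_
    rw [Ideal.mem_torsionOf_iff] at hr ⊢
    rw [pow_succ', mul_smul, smul_comm, hr, smul_zero]
  obtain ⟨n, hn⟩ := monotone_stabilizes_iff_noetherian.mpr ‹IsNoetherianRing A› ⟨_, hmono⟩
  refine ⟨n, ?_⟩
  by_contra hne
  obtain ⟨c, hc, hc0⟩ := h.exists_mem_ne_zero (L := A ∙ (a ^ n • e)) (by simpa using hne)
  obtain ⟨r, hr⟩ := Submodule.mem_span_singleton.mp hc
  have h1 : r ∈ Ideal.torsionOf A E (a ^ (n + 1) • e) := by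
    rw [Ideal.mem_torsionOf_iff, pow_succ', mul_smul, smul_comm, hr]
    exact LinearMap.smul_apply_quotient_eq_zero i ha c
  have h2 : r ∈ Ideal.torsionOf A E (a ^ n • e) := by
    have : Ideal.torsionOf A E (a ^ n • e) = Ideal.torsionOf A E (a ^ (n + 1) • e) :=
      hn (n + 1) n.le_succ
    exact this ▸ h1
  exact hc0 (hr ▸ (Ideal.mem_torsionOf_iff ..).mp h2)

/-- Every element of an injective hull of `A / p` is annihilated by a power of `p`. -/
theorem IsInjectiveHull.exists_pow_le_torsionOf [IsNoetherianRing A] (h : IsInjectiveHull i)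
    (e : E) : ∃ n : ℕ, p ^ n ≤ Ideal.torsionOf A E e := by
  refine Ideal.exists_pow_le_of_le_radical_of_fg (fun a ha => ?_) p.fg_of_isNoetherianRing
  obtain ⟨n, hn⟩ := h.exists_pow_smul_eq_zero ha e
  exact ⟨n, hn⟩

/-- Elements outside `p` act injectively on an injective hull of `A / p`. -/
theorem IsInjectiveHull.eq_zero_of_smul_eq_zero [p.IsPrime] (h : IsInjectiveHull i) {t : A}
    (ht : t ∉ p) {e : E} (he : t • e = 0) : e = 0 := by
  by_contra hne
  obtain ⟨c, hc, hc0⟩ := h.exists_mem_ne_zero (L := A ∙ e) (by simpa using hne)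
  obtain ⟨r, hr⟩ := Submodule.mem_span_singleton.mp hc
  have h1 : i (t • c) = 0 := by rw [map_smul, ← hr, smul_comm, he, smul_zero]
  have h2 : t • c = 0 := h.injective (by rw [h1, map_zero])
  obtain ⟨c, rfl⟩ := Ideal.Quotient.mk_surjective c
  have h3 : t * c ∈ p := Ideal.Quotient.eq_zero_iff_mem.mp h2
  refine hc0 ?_
  rw [Ideal.Quotient.eq_zero_iff_mem.mpr ((‹p.IsPrime›.mem_or_mem h3).resolve_left ht), map_zero]

end InjectiveHull

/-! ### Matlis duality over a local ring. -/

section Matlis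

open IsLocalRing

variable {A : Type u} [CommRing A] [IsLocalRing A] {E : Type u} [AddCommGroup E] [Module A E]
  {i : (A ⧸ maximalIdeal A) →ₗ[A] E}

/-- The socle of the injective hull of the residue field is the residue field. -/
theorem IsInjectiveHull.exists_eq_smul_of_smul_eq_zero (h : IsInjectiveHull i) {e : E}
    (he : ∀ a ∈ maximalIdeal A, a • e = 0) : ∃ b : A, e = b • i 1 := by
  by_cases hne : e = 0
  · exact ⟨0, by simp [hne]⟩
  obtain ⟨c, hc, hc0⟩ := h.exists_mem_ne_zero (L := A ∙ e) (by simpa using hne)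
  obtain ⟨r, hr⟩ := Submodule.mem_span_singleton.mp hc
  have hru : IsUnit r := by
    by_contra hr'
    exact hc0 (hr ▸ he r ((mem_maximalIdeal r).mpr hr'))
  obtain ⟨c, rfl⟩ := Ideal.Quotient.mk_surjective c
  obtain ⟨r, rfl⟩ := hru
  refine ⟨(↑r⁻¹ : A) * c, ?_⟩
  have hic : i (Ideal.Quotient.mk _ c) = c • i 1 := by
    rw [← map_smul]; congr 1
    exact (Algebra.smul_def c (1 : A ⧸ maximalIdeal A)).trans (mul_one _) |>.symm
  rw [mul_smul, ← hic, ← hr, smul_smul, Units.inv_mul, one_smul]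

/-- The injective hull of the residue field is a cogenerator. -/
theorem IsInjectiveHull.exists_apply_ne_zero (h : IsInjectiveHull i) {X : Type u} [AddCommGroup X]
    [Module A X] {x : X} (hx : x ≠ 0) : ∃ f : X →ₗ[A] E, f x ≠ 0 := by
  have := h.injective_module
  have hle : Ideal.torsionOf A X x ≤ maximalIdeal A := by
    refine le_maximalIdeal fun htop => hx ?_
    rwa [Ideal.torsionOf_eq_top_iff] at htop
  -- Extends the composite `A ∙ x ≅ A / ann x → A / m → E`, which is nonzero at `x`.
  obtain ⟨f, hf⟩ := Module.Injective.extension_property A E (A ∙ x) X (A ∙ x).subtype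
    (Submodule.subtype_injective _)
    (i ∘ₗ Submodule.factor hle ∘ₗ (Ideal.quotTorsionOfEquivSpanSingleton A X x).symm.toLinearMap)
  refine ⟨f, ?_⟩
  have h1 := LinearMap.congr_fun hf ⟨x, Submodule.mem_span_singleton_self x⟩
  have h2 : (Ideal.quotTorsionOfEquivSpanSingleton A X x).symm
      ⟨x, Submodule.mem_span_singleton_self x⟩ = Submodule.Quotient.mk 1 := by
    rw [LinearEquiv.symm_apply_eq, Ideal.quotTorsionOfEquivSpanSingleton_apply_mk, one_smul]
  simp only [LinearMap.comp_apply, LinearEquiv.coe_coe, h2, Submodule.subtype_apply] at h1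
  rw [h1, Ne, map_eq_zero_iff i h.injective]
  intro h0
  exact (Ideal.ne_top_iff_one _).mp (maximalIdeal.isMaximal A).ne_top
    (Ideal.Quotient.eq_zero_iff_mem.mp h0)

/-- Functionals separate points from submodules. -/
theorem IsInjectiveHull.exists_apply_ne_zero_of_notMem (h : IsInjectiveHull i) {X : Type u}
    [AddCommGroup X] [Module A X] {L : Submodule A X} {x : X} (hx : x ∉ L) :
    ∃ f : X →ₗ[A] E, (∀ y ∈ L, f y = 0) ∧ f x ≠ 0 := by
  obtain ⟨f, hf⟩ := h.exists_apply_ne_zero (x := L.mkQ x) (by simpa using hx)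
  exact ⟨f ∘ₗ L.mkQ, fun y hy => by simp [(Submodule.Quotient.mk_eq_zero L).mpr hy], hf⟩

/-- Modules of finite length are reflexive. -/
theorem IsInjectiveHull.exists_eval_eq_of_isFiniteLength (h : IsInjectiveHull i) {X : Type u}
    [AddCommGroup X] [Module A X] (hX : IsFiniteLength A X) (φ : (X →ₗ[A] E) →ₗ[A] E) :
    ∃ x : X, ∀ g, φ g = g x := by
  have := h.injective_module
  induction hX with
  | of_subsingleton => exact ⟨0, fun g => by rw [Subsingleton.elim g 0, map_zero]; rfl⟩
  | @of_simple_quotient X _ _ N _ hN ih =>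
    obtain ⟨I, hI, ⟨e⟩⟩ := isSimpleModule_iff_quot_maximal.mp
      (inferInstance : IsSimpleModule A (X ⧸ N))
    obtain rfl : I = maximalIdeal A := eq_maximalIdeal hI
    -- `g₀` generates the dual of `X ⧸ N`, and `φ` sends it into the socle; hence `φ` is evaluation
    -- at some `x` on functionals vanishing on `N`.
    let g₀ : (X ⧸ N) →ₗ[A] E := i ∘ₗ e.toLinearMap
    obtain ⟨c, hc⟩ := h.exists_eq_smul_of_smul_eq_zero (e := φ (g₀ ∘ₗ N.mkQ)) (by
      intro a ha
      rw [← map_smul, show a • (g₀ ∘ₗ N.mkQ) = 0 from ?_, map_zero]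
      ext x
      exact LinearMap.smul_apply_quotient_eq_zero i ha _)
    obtain ⟨x, hx⟩ := N.mkQ_surjective (e.symm (c • 1))
    have hquot (g : (X ⧸ N) →ₗ[A] E) : φ (g ∘ₗ N.mkQ) = g (N.mkQ x) := by
      obtain ⟨b, hb⟩ := h.exists_eq_smul_of_smul_eq_zero (e := g (e.symm 1)) (by
        intro a ha
        exact LinearMap.smul_apply_quotient_eq_zero (g ∘ₗ e.symm.toLinearMap) ha 1)
      have hg : g = b • g₀ := by
        suffices g ∘ₗ e.symm.toLinearMap = (b • g₀) ∘ₗ e.symm.toLinearMap by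
          ext y
          simpa using LinearMap.congr_fun this (e (Submodule.Quotient.mk y))
        refine Submodule.linearMap_qext _ (LinearMap.ext_ring ?_)
        have h1 : (maximalIdeal A).mkQ 1 = 1 := rfl
        simpa [g₀, h1] using hb
      rw [hg, LinearMap.smul_comp, map_smul, hc, hx]
      simp [g₀, smul_comm b c]
    have hsurj (g : N →ₗ[A] E) : ∃ g' : X →ₗ[A] E, g' ∘ₗ N.subtype = g :=
      Module.Injective.extension_property A E N X N.subtype N.subtype_injective g
    -- The difference of `φ` and evaluation at `x` descends along the surjective restriction to the
    -- dual of `N`, where induction applies.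
    have hfac : LinearMap.ker (LinearMap.lcomp A E N.subtype) ≤
        LinearMap.ker (φ - LinearMap.applyₗ x) := by
      intro g hg
      have hg' : N ≤ LinearMap.ker g := fun y hy => LinearMap.congr_fun hg ⟨y, hy⟩
      have := hquot (N.liftQ g hg')
      rw [Submodule.liftQ_mkQ] at this
      simp [this]
    obtain ⟨ψ, hψ⟩ : ∃ ψ : (N →ₗ[A] E) →ₗ[A] E,
        ψ ∘ₗ LinearMap.lcomp A E N.subtype = φ - LinearMap.applyₗ x := by
      let q := LinearMap.quotKerEquivOfSurjective (LinearMap.lcomp A E N.subtype) hsurj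
      refine ⟨(LinearMap.ker (LinearMap.lcomp A E N.subtype)).liftQ _ hfac ∘ₗ
        q.symm.toLinearMap, ?_⟩
      ext g
      have : q.symm (LinearMap.lcomp A E N.subtype g) = Submodule.Quotient.mk g := by
        rw [LinearEquiv.symm_apply_eq]
        rfl
      simp only [LinearMap.comp_apply, LinearEquiv.coe_coe, this, Submodule.liftQ_apply]
    obtain ⟨y, hy⟩ := ih ψ
    refine ⟨x + y, fun g => ?_⟩
    have h1 := LinearMap.congr_fun hψ g
    rw [LinearMap.comp_apply, hy] at h1
    have h2 : g y = φ g - g x := h1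
    rw [map_add, h2]
    abel

variable [IsNoetherianRing A]

/-- A Noetherian local ring with nilpotent maximal ideal is Artinian; the zero ring (`n = 0`) is not
local and is split off. -/
theorem isFiniteLength_quotient_maximalIdeal_pow (n : ℕ) :
    IsFiniteLength A (A ⧸ maximalIdeal A ^ n) := by
  rw [isFiniteLength_iff_isNoetherian_isArtinian]
  refine ⟨inferInstance, ?_⟩
  cases subsingleton_or_nontrivial (A ⧸ maximalIdeal A ^ n)
  · infer_instance
  have hloc : IsLocalRing (A ⧸ maximalIdeal A ^ n) :=
    .of_surjective' _ Ideal.Quotient.mk_surjective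
  have hle : maximalIdeal (A ⧸ maximalIdeal A ^ n) ≤
      (maximalIdeal A).map (Ideal.Quotient.mk (maximalIdeal A ^ n)) := by
    intro x hx
    obtain ⟨a, rfl⟩ := Ideal.Quotient.mk_surjective x
    exact Ideal.mem_map_of_mem _ fun ha => hx (ha.map _)
  have : IsArtinianRing (A ⧸ maximalIdeal A ^ n) := by
    rw [isArtinianRing_iff_isNilpotent_maximalIdeal]
    refine ⟨n, eq_bot_iff.mpr ((Ideal.pow_right_mono hle n).trans ?_)⟩
    rw [← Ideal.map_pow, Ideal.map_quotient_self]
  exact isArtinian_of_surjective_algebraMap (S := A) (R := A ⧸ maximalIdeal A ^ n)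
    Ideal.Quotient.mk_surjective

variable [IsAdicComplete (maximalIdeal A) A]

/-- Over a complete local ring, endomorphisms of the injective hull of the residue field are
multiplications by scalars. -/
theorem IsInjectiveHull.exists_eq_smul (h : IsInjectiveHull i) (f : E →ₗ[A] E) :
    ∃ a : A, ∀ e, f e = a • e := by
  -- Reflexivity of `A / m ^ n` makes `f` a scalar on elements killed by `m ^ n`. The scalars are
  -- compatible, and their limit serves all of `E`, which is `m`-power torsion.
  have hloc (n : ℕ) : ∃ a : A, ∀ g : (A ⧸ maximalIdeal A ^ n) →ₗ[A] E, f (g 1) = a • g 1 := by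
    obtain ⟨x, hx⟩ := h.exists_eval_eq_of_isFiniteLength
      (isFiniteLength_quotient_maximalIdeal_pow n)
      (f ∘ₗ LinearMap.applyₗ (1 : A ⧸ maximalIdeal A ^ n))
    obtain ⟨a, rfl⟩ := Ideal.Quotient.mk_surjective x
    refine ⟨a, fun g => (hx g).trans ?_⟩
    rw [← map_smul, Algebra.smul_def, mul_one]
    rfl
  choose a ha using hloc
  have hlift {n : ℕ} {e : E} (he : maximalIdeal A ^ n ≤ Ideal.torsionOf A E e) :
      ∃ g : (A ⧸ maximalIdeal A ^ n) →ₗ[A] E, g 1 = e :=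
    ⟨Submodule.liftQ _ (LinearMap.toSpanSingleton A E e) he,
      (Submodule.liftQ_apply _ _ (1 : A)).trans (one_smul A e)⟩
  have hpow {m n : ℕ} (hmn : m ≤ n) : a m - a n ∈ maximalIdeal A ^ m := by
    by_contra hne
    obtain ⟨g, hg⟩ := h.exists_apply_ne_zero
      (x := Ideal.Quotient.mk (maximalIdeal A ^ m) (a m - a n))
      (fun h0 => hne (Ideal.Quotient.eq_zero_iff_mem.mp h0))
    refine hg ?_
    have h1 := ha m g
    have h2 := ha n (g ∘ₗ Submodule.factor (Ideal.pow_le_pow_right hmn))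
    have h3 : (g ∘ₗ Submodule.factor (Ideal.pow_le_pow_right hmn)) 1 = g 1 := rfl
    rw [h3, h1] at h2
    rw [← mul_one (Ideal.Quotient.mk _ _), ← Ideal.Quotient.algebraMap_eq, ← Algebra.smul_def,
      map_smul, sub_smul, h2, sub_self]
  obtain ⟨L, hL⟩ := IsPrecomplete.prec (I := maximalIdeal A) (M := A) inferInstance (f := a) (by
    intro m n hmn
    rw [SModEq.sub_mem, smul_eq_mul, Ideal.mul_top]
    exact hpow hmn)
  refine ⟨L, fun e => ?_⟩
  obtain ⟨n, hn⟩ := h.exists_pow_le_torsionOf e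
  obtain ⟨g, rfl⟩ := hlift hn
  rw [ha n g, ← sub_eq_zero, ← sub_smul]
  have := hL n
  rw [SModEq.sub_mem, smul_eq_mul, Ideal.mul_top] at this
  exact hn this

/-- Finitely generated modules over a complete local ring are reflexive. -/
theorem IsInjectiveHull.exists_eval_eq (h : IsInjectiveHull i) {N : Type u} [AddCommGroup N]
    [Module A N] [Module.Finite A N] (φ : (N →ₗ[A] E) →ₗ[A] E) : ∃ x : N, ∀ g, φ g = g x := by
  have := h.injective_module
  obtain ⟨k, x, hx⟩ := Module.Finite.exists_fin (R := A) (M := N)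
  -- Values at generators embed the dual of `N` in `E ^ k`. An extension of `φ` to `E ^ k` is a
  -- scalar `a j` on each factor, so `φ` is evaluation at `∑ a j • x j`.
  let r : (N →ₗ[A] E) →ₗ[A] (Fin k → E) := LinearMap.pi fun j => LinearMap.applyₗ (x j)
  have hr : Function.Injective r := by
    intro f g hfg
    exact LinearMap.ext_on_range hx fun j => congr_fun hfg j
  obtain ⟨ψ, hψ⟩ := Module.Injective.extension_property A E _ _ r hr φ
  choose a ha using fun j => h.exists_eq_smul (ψ ∘ₗ LinearMap.single A (fun _ : Fin k => E) j)
  refine ⟨∑ j, a j • x j, fun g => ?_⟩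
  have hsum : r g = ∑ j, LinearMap.single A (fun _ : Fin k => E) j (g (x j)) := by
    simpa [r] using (Finset.univ_sum_single (r g)).symm
  rw [← hψ, LinearMap.comp_apply, hsum, map_sum, map_sum]
  refine Finset.sum_congr rfl fun j _ => ?_
  rw [map_smul]
  exact ha j _

theorem IsInjectiveHull.bijective_eval (h : IsInjectiveHull i) (N : Type u) [AddCommGroup N]
    [Module A N] [Module.Finite A N] :
    Function.Bijective (LinearMap.applyₗ : N →ₗ[A] (N →ₗ[A] E) →ₗ[A] E) := by
  constructor
  · rw [← LinearMap.ker_eq_bot, LinearMap.ker_eq_bot']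
    intro x hx
    by_contra hne
    obtain ⟨f, hf⟩ := h.exists_apply_ne_zero hne
    exact hf (LinearMap.congr_fun hx f)
  · intro φ
    obtain ⟨x, hx⟩ := h.exists_eval_eq φ
    exact ⟨x, LinearMap.ext fun g => (hx g).symm⟩

/-- Double annihilator theorem for submodules of the dual of a finitely generated module. -/
theorem IsInjectiveHull.mem_of_forall_apply_eq_zero (h : IsInjectiveHull i) {N : Type u}
    [AddCommGroup N] [Module A N] [Module.Finite A N] {B : Submodule A (N →ₗ[A] E)}
    {g : N →ₗ[A] E} (hg : ∀ z : N, (∀ b ∈ B, b z = 0) → g z = 0) : g ∈ B := by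
  by_contra hne
  obtain ⟨φ, hφB, hφ⟩ := h.exists_apply_ne_zero_of_notMem hne
  obtain ⟨z, hz⟩ := h.exists_eval_eq φ
  exact hφ ((hz g).trans (hg z fun b hb => (hz b).symm.trans (hφB b hb)))

/-- The dual of a finitely generated module is Artinian. -/
theorem IsInjectiveHull.isArtinian_dual (h : IsInjectiveHull i) (N : Type u) [AddCommGroup N]
    [Module A N] [Module.Finite A N] : IsArtinian A (N →ₗ[A] E) := by
  -- By the double annihilator theorem this map is strictly order-reversing, so descending chains
  -- become ascending chains in the Noetherian module `N`.
  let ann : Submodule A (N →ₗ[A] E) → Submodule A N := fun B => ⨅ b ∈ B, LinearMap.ker b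
  have hmem (B : Submodule A (N →ₗ[A] E)) (z : N) : z ∈ ann B ↔ ∀ b ∈ B, b z = 0 := by
    simp [ann]
  have hanti : StrictAnti ann := by
    intro B C hBC
    refine lt_of_le_not_ge (fun z hz => (hmem B z).mpr fun b hb => (hmem C z).mp hz b (hBC.le hb))
      fun hle => hBC.not_ge fun g hg => h.mem_of_forall_apply_eq_zero fun z hz => ?_
    exact (hmem C z).mp (hle ((hmem B z).mpr hz)) g hg
  exact hanti.wellFoundedLT

/-- Every Artinian module is the dual of a finitely generated module. -/
theorem IsInjectiveHull.exists_linearEquiv_dual (h : IsInjectiveHull i) (M : Type u)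
    [AddCommGroup M] [Module A M] [IsArtinian A M] :
    ∃ (N : Type u) (_ : AddCommGroup N) (_ : Module A N),
      Module.Finite A N ∧ Nonempty (M ≃ₗ[A] (N →ₗ[A] E)) := by
  -- A minimal finite intersection of kernels is zero, since functionals separate points; thus `M`
  -- embeds in `E ^ s`, the dual of `A ^ s`.
  obtain ⟨_, ⟨s, rfl⟩, hs⟩ := IsArtinian.set_has_minimal
    (Set.range fun s : Finset (M →ₗ[A] E) => ⨅ f ∈ s, LinearMap.ker f) ⟨_, ∅, rfl⟩
  have hker (m : M) (hm : ∀ f ∈ s, f m = 0) : m = 0 := by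
    classical
    by_contra hne
    obtain ⟨f, hf⟩ := h.exists_apply_ne_zero hne
    refine hs _ ⟨insert f s, rfl⟩ (lt_of_le_not_ge ?_ fun hle => hf ?_)
    · exact biInf_mono fun g hg => Finset.mem_insert_of_mem hg
    · have : m ∈ ⨅ g ∈ insert f s, LinearMap.ker g := hle (by simpa using hm)
      simp only [Submodule.mem_iInf] at this
      exact this f (Finset.mem_insert_self f s)
  let D : M →ₗ[A] (s → A) →ₗ[A] E :=
    { toFun := fun m => Fintype.linearCombination A fun f : s => f.1 m
      map_add' := fun m m' => by
        ext v
        simp [Fintype.linearCombination_apply, Finset.sum_add_distrib]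
      map_smul' := fun a m => by
        ext v
        simp [Fintype.linearCombination_apply, Finset.smul_sum, smul_comm a] }
  let K : Submodule A (s → A) := ⨅ m, LinearMap.ker (D m)
  have hK (v : s → A) : v ∈ K ↔ ∀ m, D m v = 0 := by simp [K]
  have hKle (m : M) : K ≤ LinearMap.ker (D m) := iInf_le _ m
  let T : M →ₗ[A] ((s → A) ⧸ K) →ₗ[A] E :=
    { toFun := fun m => K.liftQ (D m) (hKle m)
      map_add' := fun m m' => by
        refine Submodule.linearMap_qext _ ?_
        rw [LinearMap.add_comp, Submodule.liftQ_mkQ, Submodule.liftQ_mkQ, Submodule.liftQ_mkQ,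
          map_add]
      map_smul' := fun a m => by
        refine Submodule.linearMap_qext _ ?_
        rw [RingHom.id_apply, LinearMap.smul_comp, Submodule.liftQ_mkQ, Submodule.liftQ_mkQ,
          map_smul] }
  have hT (m : M) : T m ∘ₗ K.mkQ = D m := Submodule.liftQ_mkQ _ _ _
  refine ⟨(s → A) ⧸ K, inferInstance, inferInstance, inferInstance,
    ⟨LinearEquiv.ofBijective T ⟨?_, fun g => ?_⟩⟩⟩
  · classical
    rw [← LinearMap.ker_eq_bot, LinearMap.ker_eq_bot']
    intro m hm
    refine hker m fun f hf => ?_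
    have h1 : D m = 0 := by rw [← hT, hm, LinearMap.zero_comp]
    have h2 : D m (Pi.single ⟨f, hf⟩ 1) = f m :=
      (Fintype.linearCombination_apply_single A _ _ _).trans (one_smul A _)
    rw [← h2, h1, LinearMap.zero_apply]
  -- `K` is the annihilator of the range of `D`, so a functional vanishing on `K` lies in that
  -- range.
  · obtain ⟨m, hm⟩ : g ∘ₗ K.mkQ ∈ LinearMap.range D := by
      refine h.mem_of_forall_apply_eq_zero fun z hz => ?_
      have : z ∈ K := (hK z).mpr fun m => hz _ ⟨m, rfl⟩
      simp [(Submodule.Quotient.mk_eq_zero K).mpr this]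
    exact ⟨m, Submodule.linearMap_qext _ ((hT m).trans hm)⟩

end Matlis

/-! ### Transfer of the hull of `R / p` to a ring in which `R_p` is dense. -/

section HullOverCompletion

open IsLocalRing

variable {R : Type u} [CommRing R] {p : Ideal R}
  {S : Type u} [CommRing S] [IsLocalRing S] [Algebra R S]
  {F : Type u} [AddCommGroup F] [Module R F] [Module S F] [IsScalarTower R S F]
  {i' : (R ⧸ p) →ₗ[R] F}

theorem smul_eq_zero_of_forall_mem_pow_smul_eq_zero
    (hmax : maximalIdeal S = p.map (algebraMap R S)) {n : ℕ} {e : F}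
    (he : ∀ a ∈ p ^ n, a • e = 0) {s : S} (hs : s ∈ maximalIdeal S ^ n) : s • e = 0 := by
  have hle : maximalIdeal S ^ n ≤ Ideal.torsionOf S F e := by
    rw [hmax, ← Ideal.map_pow, Ideal.map_le_iff_le_comap]
    intro a ha
    rw [Ideal.mem_comap, Ideal.mem_torsionOf_iff, algebraMap_smul]
    exact he a ha
  exact hle hs

theorem IsInjectiveHull.exists_maximalIdeal_pow_smul_eq_zero [IsNoetherianRing R]
    (hmax : maximalIdeal S = p.map (algebraMap R S)) (h : IsInjectiveHull i') (e : F) :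
    ∃ n : ℕ, ∀ s ∈ maximalIdeal S ^ n, s • e = 0 := by
  obtain ⟨n, hn⟩ := h.exists_pow_le_torsionOf e
  exact ⟨n, fun s hs => smul_eq_zero_of_forall_mem_pow_smul_eq_zero hmax (fun a ha => hn ha) hs⟩

variable [p.IsPrime]

/-- `R`-linear maps from a torsion `S`-module to an injective hull `F` of `R / p` are `S`-linear. -/
theorem IsInjectiveHull.map_smul_of_torsion (hmax : maximalIdeal S = p.map (algebraMap R S))
    (hdense : ∀ (n : ℕ) (s : S), ∃ t ∉ p, ∃ r : R, t • s - algebraMap R S r ∈ maximalIdeal S ^ n)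
    (h : IsInjectiveHull i') {X : Type u} [AddCommGroup X] [Module R X] [Module S X]
    [IsScalarTower R S X] {n : ℕ} (hX : ∀ s ∈ maximalIdeal S ^ n, ∀ x : X, s • x = 0)
    (f : X →ₗ[R] F) (s : S) (x : X) : f (s • x) = s • f x := by
  -- On `x` and on `f x`, both killed by the `n`-th power of the maximal ideal, `t • s` acts as `r`.
  -- The factor `t` cancels because it acts injectively on `F`.
  obtain ⟨t, ht, r, hr⟩ := hdense n s
  have hx : t • s • x = r • x := by
    have := hX _ hr x
    rwa [sub_smul, smul_assoc, algebraMap_smul, sub_eq_zero] at this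
  have hfx : t • s • f x = r • f x := by
    have : (t • s - algebraMap R S r) • f x = 0 := by
      refine smul_eq_zero_of_forall_mem_pow_smul_eq_zero hmax (n := n) (fun a ha => ?_) hr
      rw [← map_smul, ← algebraMap_smul S a x, hX _ ?_ x, map_zero]
      rw [hmax, ← Ideal.map_pow]
      exact Ideal.mem_map_of_mem _ ha
    rwa [sub_smul, smul_assoc, algebraMap_smul, sub_eq_zero] at this
  rw [← sub_eq_zero]
  refine h.eq_zero_of_smul_eq_zero ht ?_
  rw [smul_sub, ← map_smul, hx, hfx, map_smul, sub_self]

variable [IsNoetherianRing R]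

/-- A map `g` from an ideal `J` has image killed by a power of the maximal ideal, so by Artin–Rees
it factors through the image of `J` in a quotient of `S` by a higher power. It extends there by
injectivity over `R`, and the extension is `S`-linear because the quotient is torsion. -/
theorem IsInjectiveHull.baer_of_dense [IsNoetherianRing S]
    (hmax : maximalIdeal S = p.map (algebraMap R S))
    (hdense : ∀ (n : ℕ) (s : S), ∃ t ∉ p, ∃ r : R, t • s - algebraMap R S r ∈ maximalIdeal S ^ n)
    (h : IsInjectiveHull i') : Module.Baer S F := by
  have := h.injective_module
  intro J g
  obtain ⟨n, hn⟩ : ∃ n, ∀ s ∈ maximalIdeal S ^ n, ∀ x : J, s • g x = 0 := by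
    obtain ⟨k, x, hx⟩ := Module.Finite.exists_fin (R := S) (M := J)
    choose n hn using fun j => h.exists_maximalIdeal_pow_smul_eq_zero hmax (g (x j))
    refine ⟨∑ j, n j, fun s hs y => ?_⟩
    have hy : y ∈ Submodule.span S (Set.range x) := hx ▸ Submodule.mem_top
    induction hy using Submodule.span_induction with
    | mem y hy =>
      obtain ⟨j, rfl⟩ := hy
      exact hn j s (Ideal.pow_le_pow_right
        (Finset.single_le_sum (fun _ _ => Nat.zero_le _) (Finset.mem_univ j)) hs)
    | zero => rw [map_zero, smul_zero]
    | add y z _ _ hy hz => rw [map_add, smul_add, hy, hz, add_zero]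
    | smul a y _ hy => rw [map_smul, smul_comm, hy, smul_zero]
  obtain ⟨k, hk⟩ := Ideal.exists_pow_inf_eq_pow_smul (maximalIdeal S) J
  have hg0 (x : J) (hx : (x : S) ∈ maximalIdeal S ^ (n + k)) : g x = 0 := by
    have h1 : (x : S) ∈ maximalIdeal S ^ n • J := by
      have h2 : (x : S) ∈ maximalIdeal S ^ (n + k) • (⊤ : Submodule S S) ⊓ J :=
        ⟨by simpa using hx, x.2⟩
      rw [hk _ (Nat.le_add_left k n), Nat.add_sub_cancel] at h2
      exact Submodule.smul_mono le_rfl inf_le_right h2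
    have h3 : ∀ y ∈ maximalIdeal S ^ n • J, ∃ hy : y ∈ J, g ⟨y, hy⟩ = 0 := by
      intro y hy
      induction hy using Submodule.smul_induction_on' with
      | smul s hs y hy => exact ⟨J.smul_mem s hy, (g.map_smul s ⟨y, hy⟩).trans (hn s hs _)⟩
      | add y _ z _ hy hz =>
        obtain ⟨hy, hy'⟩ := hy
        obtain ⟨hz, hz'⟩ := hz
        refine ⟨J.add_mem hy hz, (g.map_add ⟨y, hy⟩ ⟨z, hz⟩).trans ?_⟩
        rw [hy', hz', add_zero]
    exact (h3 x h1).2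
  let q : J →ₗ[S] S ⧸ maximalIdeal S ^ (n + k) := (maximalIdeal S ^ (n + k)).mkQ ∘ₗ J.subtype
  have hq : LinearMap.ker q ≤ LinearMap.ker g := by
    intro x hx
    exact hg0 x ((Submodule.Quotient.mk_eq_zero _).mp hx)
  have hinj : Function.Injective ((LinearMap.ker q).liftQ q le_rfl) := by
    rw [← LinearMap.ker_eq_bot]
    exact Submodule.ker_liftQ_eq_bot _ _ _ le_rfl
  obtain ⟨f, hf⟩ := Module.Injective.extension_property R F _ _
    (((LinearMap.ker q).liftQ q le_rfl).restrictScalars R) hinj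
    (((LinearMap.ker q).liftQ g hq).restrictScalars R)
  have hlin := h.map_smul_of_torsion hmax hdense (n := n + k) (fun s hs x => by
    obtain ⟨x, rfl⟩ := Submodule.Quotient.mk_surjective _ x
    rw [← Submodule.Quotient.mk_smul, Submodule.Quotient.mk_eq_zero]
    exact Ideal.mul_mem_right _ _ hs) f
  refine ⟨{ toFun := fun s => f (Submodule.Quotient.mk s)
            map_add' := fun s t => by rw [Submodule.Quotient.mk_add, map_add]
            map_smul' := fun s t => by
              rw [Submodule.Quotient.mk_smul, hlin, RingHom.id_apply] }, fun x hx => ?_⟩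
  exact LinearMap.congr_fun hf (Submodule.Quotient.mk ⟨x, hx⟩)

/-- An injective hull of `R / p` over `R` is an injective hull of the residue field over a ring `S`
in which the localization of `R` at `p` is dense. -/
theorem IsInjectiveHull.exists_isInjectiveHull_of_dense [IsNoetherianRing S]
    (hmax : maximalIdeal S = p.map (algebraMap R S))
    (hdense : ∀ (n : ℕ) (s : S), ∃ t ∉ p, ∃ r : R, t • s - algebraMap R S r ∈ maximalIdeal S ^ n)
    (h : IsInjectiveHull i') : ∃ j : (S ⧸ maximalIdeal S) →ₗ[S] F, IsInjectiveHull j := by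
  have hker : maximalIdeal S ≤ LinearMap.ker (LinearMap.toSpanSingleton S F (i' 1)) := by
    intro s hs
    refine smul_eq_zero_of_forall_mem_pow_smul_eq_zero hmax (n := 1) (fun a ha => ?_)
      (by rwa [pow_one])
    exact LinearMap.smul_apply_quotient_eq_zero i' (by rwa [pow_one] at ha) 1
  refine ⟨Submodule.liftQ _ _ hker, (h.baer_of_dense hmax hdense).injective, ?_, fun L hL => ?_⟩
  · rw [← LinearMap.ker_eq_bot, LinearMap.ker_eq_bot']
    intro x hx
    obtain ⟨s, rfl⟩ := Submodule.Quotient.mk_surjective _ x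
    rw [Submodule.Quotient.mk_eq_zero]
    by_contra hs
    have hx' : s • i' 1 = 0 := hx
    obtain ⟨s, rfl⟩ : IsUnit s := by simpa using hs
    have h0 : i' 1 = 0 := by
      rw [← one_smul S (i' 1), ← s.inv_mul, mul_smul, hx', smul_zero]
    exact one_ne_zero (h.injective (h0.trans (map_zero i').symm))
  -- Essentiality passes up from `R`: the image of `R / p` lies in the image of the residue field of
  -- `S`.
  · have : L.restrictScalars R = ⊥ := by
      refine h.essential _ (eq_bot_iff.mpr ?_)
      rintro _ ⟨hx, c, rfl⟩
      obtain ⟨r, rfl⟩ := Ideal.Quotient.mk_surjective c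
      suffices i' (Ideal.Quotient.mk p r) ∈ (⊥ : Submodule S F) from this
      rw [← hL]
      refine ⟨hx, Submodule.Quotient.mk (algebraMap R S r), ?_⟩
      rw [Submodule.liftQ_apply, LinearMap.toSpanSingleton_apply, algebraMap_smul, ← map_smul]
      congr 1
      exact (Algebra.smul_def r (1 : R ⧸ p)).trans (mul_one _)
    simpa using this

end HullOverCompletion

/-! ### The completed localization as such a ring. -/

section LocCompl

open IsLocalRing

variable {R : Type u} [CommRing R] [IsNoetherianRing R] (p : Ideal R) [p.IsPrime]

instance LocCompl.isScalarTower : IsScalarTower R (Localization.AtPrime p) (LocCompl p) :=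
  .of_algebraMap_eq fun _ => rfl

instance LocCompl.isNoetherianRing_localization : IsNoetherianRing (Localization.AtPrime p) :=
  IsLocalization.isNoetherianRing p.primeCompl _ inferInstance

theorem LocCompl.maximalIdeal_eq_map :
    maximalIdeal (LocCompl p) = p.map (algebraMap R (LocCompl p)) := by
  rw [AdicCompletion.maximalIdeal_eq_map,
    IsScalarTower.algebraMap_eq R (Localization.AtPrime p) (LocCompl p), ← Ideal.map_map,
    Localization.AtPrime.map_eq_maximalIdeal]

/-- Approximate `s` by a fraction in `R_p` and clear its denominator `t`. -/
theorem LocCompl.exists_smul_sub_algebraMap_mem (n : ℕ) (s : LocCompl p) :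
    ∃ t ∉ p, ∃ r : R, t • s - algebraMap R (LocCompl p) r ∈ maximalIdeal (LocCompl p) ^ n := by
  obtain ⟨a, ha⟩ := Ideal.exists_sub_mem_pow_map (maximalIdeal (Localization.AtPrime p))
    (AdicCompletion.exists_sub_algebraMap_mem_map _ (Ideal.fg_of_isNoetherianRing _)) n s
  obtain ⟨r, t, rfl⟩ := IsLocalization.exists_mk'_eq p.primeCompl a
  refine ⟨t, t.2, r, ?_⟩
  rw [AdicCompletion.maximalIdeal_eq_map]
  have h1 : algebraMap R (LocCompl p) r = (t : R) • algebraMap (Localization.AtPrime p) (LocCompl p)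
      (IsLocalization.mk' (Localization.AtPrime p) r t) := by
    rw [Algebra.smul_def, IsScalarTower.algebraMap_apply R (Localization.AtPrime p) (LocCompl p),
      IsScalarTower.algebraMap_apply R (Localization.AtPrime p) (LocCompl p), ← map_mul,
      IsLocalization.mk'_spec']
  rw [h1, ← smul_sub, Algebra.smul_def]
  exact Ideal.mul_mem_left _ _ ha

theorem IsInjectiveHull.exists_isInjectiveHull_locCompl {F : Type u} [AddCommGroup F]
    [Module R F] [Module (LocCompl p) F] [IsScalarTower R (LocCompl p) F]
    {i' : (R ⧸ p) →ₗ[R] F} (h : IsInjectiveHull i') :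
    ∃ j : (LocCompl p ⧸ maximalIdeal (LocCompl p)) →ₗ[LocCompl p] F, IsInjectiveHull j :=
  h.exists_isInjectiveHull_of_dense (LocCompl.maximalIdeal_eq_map p)
    (LocCompl.exists_smul_sub_algebraMap_mem p)

end LocCompl
open IsLocalRing

/-! ### Completed localization as base change. -/

section BaseChange

variable {R : Type u} [CommRing R] (p : Ideal R) [p.IsPrime]

/-- The canonical map from a module to its completed localization. -/
noncomputable def LocComplModule.of (N : Type u) [AddCommGroup N] [Module R N] :
    N →ₗ[R] LocComplModule p N :=
  (AdicCompletion.of (maximalIdeal (Localization.AtPrime p))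
    (LocalizedModule p.primeCompl N)).restrictScalars R ∘ₗ
      LocalizedModule.mkLinearMap p.primeCompl N

instance LocComplModule.isScalarTower (N : Type u) [AddCommGroup N] [Module R N] :
    IsScalarTower R (LocCompl p) (LocComplModule p N) :=
  .of_algebraMap_smul fun r z => by
    rw [IsScalarTower.algebraMap_apply R (Localization.AtPrime p) (LocCompl p), algebraMap_smul,
      algebraMap_smul]

theorem LocComplModule.map_of {N N' : Type u} [AddCommGroup N] [Module R N]
    [AddCommGroup N'] [Module R N'] (f : N →ₗ[R] N') (x : N) :
    LocComplModule.map p f (LocComplModule.of p N x) = LocComplModule.of p N' (f x) := by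
  refine (AdicCompletion.map_of _ _ _).trans (congr_arg _ ?_)
  exact IsLocalizedModule.map_apply p.primeCompl (LocalizedModule.mkLinearMap p.primeCompl N)
    (LocalizedModule.mkLinearMap p.primeCompl N') f x

variable [IsNoetherianRing R]

/-- Localization is a base change, and so is completion of finite modules over a Noetherian ring. -/
theorem LocComplModule.isBaseChange_of (N : Type u) [AddCommGroup N] [Module R N]
    [Module.Finite R N] : IsBaseChange (LocCompl p) (LocComplModule.of p N) := by
  have h1 : IsBaseChange (Localization.AtPrime p) (LocalizedModule.mkLinearMap p.primeCompl N) :=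
    (isLocalizedModule_iff_isBaseChange p.primeCompl _ _).mp inferInstance
  have : Module.Finite (Localization.AtPrime p) (LocalizedModule p.primeCompl N) :=
    inferInstance
  have h2 : IsBaseChange (LocCompl p) (AdicCompletion.of (maximalIdeal (Localization.AtPrime p))
      (LocalizedModule p.primeCompl N)) :=
    .of_equiv (AdicCompletion.ofTensorProductEquivOfFiniteNoetherian _ _) fun x => by
      simp
  exact h1.comp h2

theorem LocComplModule.finite (N : Type u) [AddCommGroup N] [Module R N] [Module.Finite R N] :
    Module.Finite (LocCompl p) (LocComplModule p N) :=
  Module.Finite.equiv (LocComplModule.isBaseChange_of p N).equiv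

/-- Reduces vanishing of a functional on the completed submodule to vanishing on `L`. -/
theorem LocComplModule.ofSubmodule_eq_span {N : Type u} [AddCommGroup N] [Module R N]
    [Module.Finite R N] (L : Submodule R N) : LocComplModule.ofSubmodule p L =
      Submodule.span (LocCompl p) (LocComplModule.of p N '' L) := by
  refine le_antisymm ?_ (Submodule.span_le.mpr ?_)
  · rintro _ ⟨z, rfl⟩
    induction z using (LocComplModule.isBaseChange_of p L).inductionOn with
    | zero => simp
    | tmul x =>
      rw [LocComplModule.map_of]
      exact Submodule.subset_span ⟨x, x.2, rfl⟩
    | smul s z hz => rw [map_smul]; exact Submodule.smul_mem _ _ hz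
    | add y z hy hz => rw [map_add]; exact add_mem hy hz
  · rintro _ ⟨x, hx, rfl⟩
    exact ⟨LocComplModule.of p L ⟨x, hx⟩, LocComplModule.map_of p L.subtype ⟨x, hx⟩⟩

variable (F : Type u) [AddCommGroup F] [Module R F] [Module (LocCompl p) F]
  [IsScalarTower R (LocCompl p) F] (N : Type u) [AddCommGroup N] [Module R N]

/-- Restriction of functionals along the canonical map `N → LocComplModule p N`. -/
noncomputable def LocComplModule.homRestrict :
    (LocComplModule p N →ₗ[LocCompl p] F) →ₗ[LocCompl p] (N →ₗ[R] F) where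
  toFun g := g.restrictScalars R ∘ₗ LocComplModule.of p N
  map_add' _ _ := rfl
  map_smul' _ _ := rfl

theorem LocComplModule.homRestrict_bijective [Module.Finite R N] :
    Function.Bijective (LocComplModule.homRestrict p F N) := by
  have h := LocComplModule.isBaseChange_of p N
  refine ⟨fun f g hfg => h.algHom_ext f g fun x => LinearMap.congr_fun hfg x, fun g => ?_⟩
  exact ⟨h.lift g, h.lift_comp g⟩

end BaseChange

/-! ### Colocalized submodules as annihilators. -/

section Coloc

variable {R : Type u} [CommRing R] {S : Type u} [CommRing S] [Algebra R S]
  {E F : Type u} [AddCommGroup E] [Module R E] [AddCommGroup F] [Module R F] [Module S F]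
  [IsScalarTower R S F]

/-- The colocalization of a submodule consists of the maps that vanish on the functionals
annihilating it. -/
theorem Coloc.mem_ofSubmodule_iff [Module.Injective R E] {M : Type u} [AddCommGroup M] [Module R M]
    (L : Submodule R M) (f : Coloc R E F M) : f ∈ Coloc.ofSubmodule S E F L ↔
      ∀ ξ : M →ₗ[R] E, (∀ x ∈ L, ξ x = 0) → f ξ = 0 := by
  constructor
  · rintro ⟨g, rfl⟩ ξ hξ
    have : LinearMap.lcomp R E L.subtype ξ = 0 := LinearMap.ext fun x => hξ x x.2
    exact (congr_arg g this).trans (map_zero g)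
  · intro hf
    -- Since `E` is injective, the dual of `L` is a quotient of the dual of `M`, and `f` descends to
    -- it.
    have hsurj : Function.Surjective (LinearMap.lcomp R E L.subtype) := fun ξ =>
      Module.Injective.extension_property R E L M L.subtype L.subtype_injective ξ
    have hker : LinearMap.ker (LinearMap.lcomp R E L.subtype) ≤ LinearMap.ker f :=
      fun ξ hξ => hf ξ fun x hx => LinearMap.congr_fun hξ ⟨x, hx⟩
    let q := LinearMap.quotKerEquivOfSurjective _ hsurj
    refine ⟨(LinearMap.ker (LinearMap.lcomp R E L.subtype)).liftQ f hker ∘ₗ q.symm.toLinearMap,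
      LinearMap.ext fun ξ => ?_⟩
    have : q.symm (LinearMap.lcomp R E L.subtype ξ) = Submodule.Quotient.mk ξ := by
      rw [LinearEquiv.symm_apply_eq]
      rfl
    exact (congr_arg ((LinearMap.ker (LinearMap.lcomp R E L.subtype)).liftQ f hker) this).trans
      (Submodule.liftQ_apply _ _ _)

/-- Isomorphic modules have isomorphic colocalizations. -/
def Coloc.congr (S : Type u) [CommRing S] [Algebra R S] (E F : Type u) [AddCommGroup E]
    [Module R E] [AddCommGroup F] [Module R F] [Module S F] [IsScalarTower R S F]
    {M M' : Type u} [AddCommGroup M] [Module R M] [AddCommGroup M'] [Module R M']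
    (e : M ≃ₗ[R] M') : Coloc R E F M ≃ₗ[S] Coloc R E F M' :=
  (e.congrLeft E R).congrLeft F S

theorem Coloc.map_congr_ofSubmodule [Module.Injective R E] {M M' : Type u} [AddCommGroup M]
    [Module R M] [AddCommGroup M'] [Module R M'] (e : M ≃ₗ[R] M') (L : Submodule R M) :
    (Coloc.ofSubmodule S E F L).map (Coloc.congr S E F e).toLinearMap =
      Coloc.ofSubmodule S E F (L.map e.toLinearMap) := by
  ext f
  rw [Submodule.mem_map_equiv, Coloc.mem_ofSubmodule_iff, Coloc.mem_ofSubmodule_iff]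
  constructor
  · intro h ξ hξ
    have := h (ξ ∘ₗ e.toLinearMap) fun x hx => hξ _ ⟨x, hx, rfl⟩
    convert this using 1
    change f ξ = f ((ξ ∘ₗ e.toLinearMap) ∘ₗ e.symm.toLinearMap)
    congr 1
    ext x
    simp
  · intro h ξ hξ
    refine h (ξ ∘ₗ e.symm.toLinearMap) ?_
    rintro _ ⟨x, hx, rfl⟩
    simpa using hξ x hx

/-- Compatibility of selectors with colocalization is invariant under isomorphism. -/
theorem SubmoduleSelector.coloc_eq_of_linearEquiv [Module.Injective R E]
    (σ : SubmoduleSelector R (artinianModules R)) (σ' : SubmoduleSelector S (artinianModules S))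
    {M M' : Type u} [AddCommGroup M] [Module R M] [AddCommGroup M'] [Module R M']
    (e : M ≃ₗ[R] M') [IsArtinian R M] [IsArtinian S (Coloc R E F M)]
    (h : σ'.toFun (Coloc R E F M) = Coloc.ofSubmodule S E F (σ.toFun M)) :
    σ'.toFun (Coloc R E F M') = Coloc.ofSubmodule S E F (σ.toFun M') := by
  have : IsArtinian R M' := isArtinian_of_linearEquiv e
  have : IsArtinian S (Coloc R E F M') := isArtinian_of_linearEquiv (Coloc.congr S E F e)
  rw [← σ'.map_equiv _ _ (Coloc.congr S E F e) ‹_› ‹_›, ← σ.map_equiv _ _ e ‹_› ‹_›, h,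
    Coloc.map_congr_ofSubmodule]

end Coloc

/-! ### Comparison of the two dualities. -/

section Duality

variable {R : Type u} [CommRing R] [IsLocalRing R] [IsNoetherianRing R]
  [IsAdicComplete (maximalIdeal R) R] (p : Ideal R) [p.IsPrime]
  {E : Type u} [AddCommGroup E] [Module R E] {i : (R ⧸ maximalIdeal R) →ₗ[R] E}
  {F : Type u} [AddCommGroup F] [Module R F] [Module (LocCompl p) F]
  [IsScalarTower R (LocCompl p) F]

/-- The dual of the completed localization of `N` is the colocalization of the dual of `N`. -/
noncomputable def IsInjectiveHull.dualEquivColoc (hE : IsInjectiveHull i) (F : Type u)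
    [AddCommGroup F] [Module R F] [Module (LocCompl p) F] [IsScalarTower R (LocCompl p) F]
    (N : Type u) [AddCommGroup N] [Module R N] [Module.Finite R N] :
    (LocComplModule p N →ₗ[LocCompl p] F) ≃ₗ[LocCompl p] Coloc R E F (N →ₗ[R] E) :=
  (LinearEquiv.ofBijective _ (LocComplModule.homRestrict_bijective p F N)).trans
    ((LinearEquiv.ofBijective _ (hE.bijective_eval N)).congrLeft F (LocCompl p))

theorem IsInjectiveHull.dualEquivColoc_apply (hE : IsInjectiveHull i) {N : Type u}
    [AddCommGroup N] [Module R N] [Module.Finite R N]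
    (g : LocComplModule p N →ₗ[LocCompl p] F) (x : N) :
    hE.dualEquivColoc p F N g (LinearMap.applyₗ x) = g (LocComplModule.of p N x) := by
  let ε := LinearEquiv.ofBijective _ (hE.bijective_eval N)
  change g (LocComplModule.of p N (ε.symm (ε x))) = _
  rw [ε.symm_apply_apply]

/-- Every functional on the dual of `N` is evaluation at some `x`, and it annihilates the selected
submodule exactly when `x` lies in the smile dual. -/
theorem IsInjectiveHull.dualEquivColoc_mem_ofSubmodule_iff (hE : IsInjectiveHull i)
    (σ : SubmoduleSelector R (artinianModules R)) {N : Type u}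
    [AddCommGroup N] [Module R N] [Module.Finite R N]
    (g : LocComplModule p N →ₗ[LocCompl p] F) :
    hE.dualEquivColoc p F N g ∈
        Coloc.ofSubmodule (LocCompl p) E F (σ.toFun (N →ₗ[R] E)) ↔
      ∀ z ∈ LocComplModule.ofSubmodule p (σ.smileFun E N), g z = 0 := by
  have := hE.injective_module
  rw [Coloc.mem_ofSubmodule_iff, LocComplModule.ofSubmodule_eq_span]
  constructor
  · intro h z hz
    have hle : Submodule.span (LocCompl p) (LocComplModule.of p N '' σ.smileFun E N) ≤
        LinearMap.ker g := by
      rw [Submodule.span_le]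
      rintro _ ⟨x, hx, rfl⟩
      refine (hE.dualEquivColoc_apply p g x).symm.trans (h _ fun b hb => ?_)
      exact (σ.mem_smileFun E N x).mp hx b hb
    exact hle hz
  · intro h ξ hξ
    obtain ⟨x, rfl⟩ := (hE.bijective_eval N).2 ξ
    rw [hE.dualEquivColoc_apply p]
    exact h _ (Submodule.subset_span ⟨x, (σ.mem_smileFun E N x).mpr hξ, rfl⟩)

variable {j : (LocCompl p ⧸ maximalIdeal (LocCompl p)) →ₗ[LocCompl p] F}

theorem IsInjectiveHull.isArtinian_coloc_dual (hE : IsInjectiveHull i) (hj : IsInjectiveHull j)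
    (N : Type u) [AddCommGroup N] [Module R N] [Module.Finite R N] :
    IsArtinian (LocCompl p) (Coloc R E F (N →ₗ[R] E)) :=
  have := LocComplModule.finite p N
  have := hj.isArtinian_dual (LocComplModule p N)
  isArtinian_of_linearEquiv (hE.dualEquivColoc p F N)

/-- For a finitely generated module `N`, the smile duals of `σ` and `σ'` are compatible with
completed localization of `N` if and only if `σ` and `σ'` are compatible with colocalization of the
dual of `N`. -/
theorem IsInjectiveHull.smile_eq_ofSubmodule_iff (hE : IsInjectiveHull i)
    (hj : IsInjectiveHull j) (σ : SubmoduleSelector R (artinianModules R))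
    (σ' : SubmoduleSelector (LocCompl p) (artinianModules (LocCompl p)))
    (N : Type u) [AddCommGroup N] [Module R N] [Module.Finite R N] :
    σ'.smileFun F (LocComplModule p N) = LocComplModule.ofSubmodule p (σ.smileFun E N) ↔
      σ'.toFun (Coloc R E F (N →ₗ[R] E)) =
        Coloc.ofSubmodule (LocCompl p) E F (σ.toFun (N →ₗ[R] E)) := by
  have := LocComplModule.finite p N
  set U := LocComplModule p N
  set Φ := hE.dualEquivColoc p F N
  have hσ' : (σ'.toFun (U →ₗ[LocCompl p] F)).map Φ.toLinearMap =
      σ'.toFun (Coloc R E F (N →ₗ[R] E)) :=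
    σ'.map_equiv _ _ Φ (hj.isArtinian_dual U) (hE.isArtinian_coloc_dual p hj N)
  have hiff : σ'.toFun (Coloc R E F (N →ₗ[R] E)) =
        Coloc.ofSubmodule (LocCompl p) E F (σ.toFun (N →ₗ[R] E)) ↔
      ∀ g, g ∈ σ'.toFun (U →ₗ[LocCompl p] F) ↔
        ∀ z ∈ LocComplModule.ofSubmodule p (σ.smileFun E N), g z = 0 := by
    rw [← hσ', SetLike.ext_iff, Φ.surjective.forall]
    refine forall_congr' fun g => ?_
    rw [Submodule.mem_map_equiv, Φ.symm_apply_apply, hE.dualEquivColoc_mem_ofSubmodule_iff p]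
  rw [hiff]
  constructor
  · intro h g
    constructor
    · intro hg z hz
      rw [← h, σ'.mem_smileFun F] at hz
      exact hz g hg
    · intro hg
      -- Double annihilator in the dual of `U`; the converse direction below uses separation of
      -- points from submodules of `U`.
      refine hj.mem_of_forall_apply_eq_zero fun z hz => hg z ?_
      rwa [← h, σ'.mem_smileFun F]
  · intro h
    ext z
    rw [σ'.mem_smileFun F]
    constructor
    · intro hz
      by_contra hne
      obtain ⟨g, hg, hgz⟩ := hj.exists_apply_ne_zero_of_notMem hne
      exact hgz (hz g ((h g).mpr hg))
    · intro hz g hg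
      exact (h g).mp hg z hz

end Duality

theorem theorem13p3 {R : Type u} [CommRing R] [IsLocalRing R] [IsNoetherianRing R]
    [IsAdicComplete (IsLocalRing.maximalIdeal R) R] (p : Ideal R) [p.IsPrime]
    -- an injective hull `E` of `R/m`
    {E : Type u} [AddCommGroup E] [Module R E] (i : (R ⧸ IsLocalRing.maximalIdeal R) →ₗ[R] E)
    (hE : IsInjectiveHull i)
    -- an injective hull `E'` of `R/p`, with its module structure over the completion of `R_p`
    {E' : Type u} [AddCommGroup E'] [Module R E'] [Module (LocCompl p) E']
    [IsScalarTower R (LocCompl p) E'] (i' : (R ⧸ p) →ₗ[R] E') (hE' : IsInjectiveHull i')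
    (σ : SubmoduleSelector R (artinianModules R))
    (σ' : SubmoduleSelector (LocCompl p) (artinianModules (LocCompl p))) :
    (∀ (N : Type u) [AddCommGroup N] [Module R N], Module.Finite R N →
      (σ'.smile E').toFun (LocComplModule p N) =
        LocComplModule.ofSubmodule p ((σ.smile E).toFun N)) ↔
    (∀ (M : Type u) [AddCommGroup M] [Module R M], IsArtinian R M →
      σ'.toFun (Coloc R E E' M) = Coloc.ofSubmodule (LocCompl p) E E' (σ.toFun M)) := by
  have := hE.injective_module
  obtain ⟨j, hj⟩ := hE'.exists_isInjectiveHull_locCompl p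
  constructor
  · intro h M _ _ _
    obtain ⟨N, _, _, _, ⟨e⟩⟩ := hE.exists_linearEquiv_dual M
    have := hE.isArtinian_dual N
    have := hE.isArtinian_coloc_dual p hj N
    exact σ.coloc_eq_of_linearEquiv σ' e.symm
      ((hE.smile_eq_ofSubmodule_iff p hj σ σ' N).mp (h N inferInstance))
  · intro h N _ _ _
    exact (hE.smile_eq_ofSubmodule_iff p hj σ σ' N).mpr (h _ (hE.isArtinian_dual N))
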